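/- Let $\Sigma$ be a finite nonempty alphabet with a fixed (arbitrary) padding symbol $\Box\in\Sigma$. For $n\in\mathbb N$ and a stream $x\in\Sigma^*$ let $\mathrm{last}_n(x)$ be the suffix of length $n$ of $x$ if $|x|\ge n$, and $\Box^{\,n-|x|}x$ otherwise; for $L\subseteq\Sigma^*$ put $\mathrm{SW}_n(L)=\{x\in\Sigma^* : \mathrm{last}_n(x)\in L\}$. A randomized streaming algorithm over $\Sigma$ is a probabilistic automaton $P=(Q,\Sigma,\iota,\rho,F)$ with a nonempty, possibly infinite, state set $Q$, an initial distribution $\iota$ on $Q$, transition distributions $\rho(p,a,\cdot)$ on $Q$ for $p\in Q$, $a\in\Sigma$, and final states $F\subseteq Q$. It accepts $w$ with the probability that its state after reading $w$ lies in $F$, and otherwise rejects $w$; its space is $\log_2|Q|\in[0,\infty]$. It is true-biased for a language $K$ if it accepts every $w\in K$ with probability at least $2/3$ and rejects every $w\notin K$ with probability $1$; it is false-biased for $K$ if it accepts every $w\in K$ with probability $1$ and rejects every $w\notin K$ with probability at least $2/3$. Let $F^{\mathsf 0}_L(n)$ (resp. $F^{\mathsf 1}_L(n)$) be the minimal space of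 a true-biased (resp. false-biased) algorithm for $\mathrm{SW}_n(L)$. A nondeterministic sliding-window algorithm for $L$ and window size $n$ is a nondeterministic finite automaton (possibly with several initial states) accepting exactly $\mathrm{SW}_n(L)$. Let $\mathbf{Len}$ be the class of regular languages $K\subseteq\Sigma^*$ such that for every $n\ge 0$ either $\Sigma^n\subseteq K$ or $\Sigma^n\cap K=\emptyset$; let $\mathbf{ST}$ be the class of finite Boolean combinations of languages $\Sigma^*w$ with $w\in\Sigma^*$; let $\mathbf{LI}$ be the class of languages $\Sigma^*K$ with $K\subseteq\Sigma^*$ regular. For classes $\mathbf A,\mathbf B$ let $\langle\mathbf A,\mathbf B\rangle$ be the class of finite Boolean combinations of members of $\mathbf A\cup\mathbf B$. Write $f(n)=\bar\Omega(g(n))$ if there is $c>0$ with $f(n)\ge c\,g(n)$ for infinitely many $n$. **Theorem.** Let $L\subseteq\Sigma^*$ be regular. 1. If $L\in\langle\mathbf{ST},\mathbf{Len}\rangle$, then $F^{\mathsf 0}_L(n)$ and $F^{\mathsf 1}_L(n)$ are $O(1)$. 2. If $L\notin\langle\mathbf{ST},\mathbf{Len}\rangle$, then $F^{\mathsf 0}_L(n)$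 and $F^{\mathsf 1}_L(n)$ are $\bar\Omega(\log n)$. 3. If $L\in\langle\mathbf{LI},\mathbf{Len}\rangle$, then $F^{\mathsf 0}_L(n)$ and $F^{\mathsf 1}_L(n)$ are $O(\log n)$. 4. If $L\notin\langle\mathbf{LI},\mathbf{Len}\rangle$, then $F^{\mathsf 0}_L(n)$ and $F^{\mathsf 1}_L(n)$ are $\bar\Omega(n)$. 5. If $L\notin\langle\mathbf{ST},\mathbf{Len}\rangle$, then there is $c>0$ such that for infinitely many $n$ every nondeterministic sliding-window algorithm for $L$ and window size $n$ has at least $c\sqrt n$ states. -/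

import Mathlib

open Filter
open scoped ENNReal

namespace SlidingWindow

section Windows

variable {α : Type*}

/-- The window of length `n`: the suffix of `x` of length `n`, padded on the left with the
symbol `pad` if `x` is shorter than `n`. -/
def lastWindow (pad : α) (n : ℕ) (x : List α) : List α :=
  if n ≤ x.length then x.drop (x.length - n) else List.replicate (n - x.length) pad ++ x

/-- The sliding window problem of `L` for window length `n`: all streams whose window of
length `n` belongs to `L`. -/
def SW (pad : α) (L : Language α) (n : ℕ) : Language α :=
  {x : List α | lastWindow pad n x ∈ L}

end Windows

section LanguageClasses

variable (α : Type*)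

/-- Suffix-testable languages: finite Boolean combinations of languages `Σ* w`. -/
def SuffixTestable : Set (Language α) :=
  {L | L ∈ BooleanSubalgebra.closure
    {K : Language α | ∃ w : List α, K = (⊤ : Language α) * ({w} : Language α)}}

/-- Regular length languages: for each `n`, all words of length `n` belong to `L`, or none. -/
def RegularLength : Set (Language α) :=
  {L | L.IsRegular ∧ ∀ n : ℕ,
    (∀ w : List α, w.length = n → w ∈ L) ∨ (∀ w : List α, w.length = n → w ∉ L)}

/-- Regular left ideals: languages `Σ* K` with `K` regular. -/
def RegularLeftIdeal : Set (Language α) :=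
  {L | ∃ K : Language α, K.IsRegular ∧ L = (⊤ : Language α) * K}

/-- Finite Boolean combinations of suffix-testable languages and regular length languages. -/
def STLen : Set (Language α) :=
  {L | L ∈ BooleanSubalgebra.closure (SuffixTestable α ∪ RegularLength α)}

/-- Finite Boolean combinations of regular left ideals and regular length languages. -/
def LILen : Set (Language α) :=
  {L | L ∈ BooleanSubalgebra.closure (RegularLeftIdeal α ∪ RegularLength α)}

end LanguageClasses

/-- A randomized streaming algorithm (probabilistic automaton) over the alphabet `α` with set of
memory states `Q`, which may be infinite. -/
structure RandomizedAlgorithm (α : Type*) (Q : Type*) where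
  /-- initial state distribution -/
  init : PMF Q
  /-- transition probabilities -/
  step : Q → α → PMF Q
  /-- final states -/
  accept : Set Q

namespace RandomizedAlgorithm

variable {α Q : Type*} (P : RandomizedAlgorithm α Q)

/-- The distribution of the memory state after reading `w`. -/
noncomputable def run (w : List α) : PMF Q :=
  w.foldl (fun X a => X.bind fun p => P.step p a) P.init

/-- The probability that `w` is accepted. -/
noncomputable def acceptProb (w : List α) : ℝ≥0∞ :=
  (P.run w).toOuterMeasure P.accept

/-- The probability that `w` is rejected. -/
noncomputable def rejectProb (w : List α) : ℝ≥0∞ :=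
  (P.run w).toOuterMeasure P.acceptᶜ

/-- `P` is a true-biased streaming algorithm for the language `K`. -/
def IsTrueBiasedFor (K : Language α) : Prop :=
  ∀ w : List α, (w ∈ K → 2 / 3 ≤ P.acceptProb w) ∧ (w ∉ K → P.rejectProb w = 1)

/-- `P` is a false-biased streaming algorithm for the language `K`. -/
def IsFalseBiasedFor (K : Language α) : Prop :=
  ∀ w : List α, (w ∈ K → P.acceptProb w = 1) ∧ (w ∉ K → 2 / 3 ≤ P.rejectProb w)

end RandomizedAlgorithm

open Classical in
/-- The space, in bits, used by a streaming algorithm with set of memory states `Q`: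
`log₂ |Q|`, which is `∞` if `Q` is infinite. -/
noncomputable def space (Q : Type*) : ℝ≥0∞ :=
  if Finite Q then ENNReal.ofReal (Real.logb 2 (Nat.card Q)) else ⊤

/-- The minimal space of a true-biased sliding window algorithm for `L` and window length `n`. -/
noncomputable def trueBiasedComplexity {α : Type*} (pad : α) (L : Language α) (n : ℕ) : ℝ≥0∞ :=
  ⨅ (Q : Type) (P : RandomizedAlgorithm α Q) (_ : P.IsTrueBiasedFor (SW pad L n)), space Q

/-- The minimal space of a false-biased sliding window algorithm for `L` and window length `n`. -/
noncomputable def falseBiasedComplexity {α : Type*} (pad : α) (L : Language α) (n : ℕ) : ℝ≥0∞ :=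
  ⨅ (Q : Type) (P : RandomizedAlgorithm α Q) (_ : P.IsFalseBiasedFor (SW pad L n)), space Q

/-- `f(n) = O(g(n))`; in particular `f(n)` is finite for all large `n`. -/
def BigO (f : ℕ → ℝ≥0∞) (g : ℕ → ℝ) : Prop :=
  ∃ C : ℝ, ∀ᶠ n in atTop, f n ≤ ENNReal.ofReal (C * g n)

/-- `f(n) = Ω̄(g(n))`: for some `c > 0`, `f(n) ≥ c g(n)` for infinitely many `n`. -/
def BigOmegaInf (f : ℕ → ℝ≥0∞) (g : ℕ → ℝ) : Prop :=
  ∃ c : ℝ, 0 < c ∧ ∃ᶠ n in atTop, ENNReal.ofReal (c * g n) ≤ f n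

end SlidingWindow

/-!
Windows are suffixes, so `L` is studied through its right quotients `{s | s ++ w ∈ L}`, the states
of the minimal automaton reading from right to left.

If, for some `k`, membership in `L` depends only on the length of a word and its last `k` letters,
then `L` lies in `STLen`. Otherwise some `x ++ w ∈ L` and `y ++ w ∉ L` with `|x| = |y|` and some
nonempty `z` satisfy `rightQuotient L (z ++ w) = rightQuotient L w`. A sliding window automaton for
window length `|x zᵐ w|` accepts `x zᵐ w` and rejects `y zᵐ w`, although the same windows occur
after every `u zᵇ w` with `b > m`. Reading `z` is a step of a unary automaton, and a unary
nondeterministic automaton with `k` states cannot distinguish `m ≥ 2k²` from `m + t * k!`, so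
`m < 2k²`: this gives the bound `√n`. The transitions of positive probability of a true-biased
algorithm form a nondeterministic automaton, whence the bound `log n`.

If `L` is well-behaved, then the pairs (right quotient, length modulo `N`) realized by the suffixes
of a word determine membership in `L`, and each such pair gives a regular left ideal, so that `L`
lies in `LILen`. Otherwise two words `u`, `v` of equal length return to the strongly connected
component of their starting point with different outcomes. Words composed of extensions of `u`
and `v` store bits, each of which is queried by shifting the window to the corresponding position.
Averaging over the random state after the data is read yields a single state from which two thirds
of the queries are answered correctly, and positive answers are never wrong, so that exponentially
many states are needed.

Conversely, for a regular left ideal it suffices to store, for every state `p` of an automaton, the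
length of the shortest suffix that leads to `p`, which takes `O(log n)` bits.
False-biased algorithms for `L` are the complements of true-biased ones for `Lᶜ`.
-/

namespace SlidingWindow

section Languages

variable {α : Type*}

theorem mem_booleanSubalgebra_of_separating {X ι : Type*} [Finite ι] (B : BooleanSubalgebra (Set X))
    {K : ι → Set X} (hK : ∀ i, K i ∈ B) {s : Set X}
    (hs : ∀ x y, (∀ i, x ∈ K i ↔ y ∈ K i) → x ∈ s → y ∈ s) : s ∈ B := by
  classical
  let signature : X → Set ι := fun x => {i | x ∈ K i}
  have fiber_eq (t : Set ι) : signature ⁻¹' {t} = ⨅ i, if i ∈ t then K i else (K i)ᶜ := by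
    ext x
    rw [Set.mem_preimage, Set.mem_singleton_iff, Set.ext_iff, Set.iInf_eq_iInter, Set.mem_iInter]
    refine forall_congr' fun i => ?_
    by_cases hi : i ∈ t <;> simp [signature, hi]
  have fiber_mem (t : Set ι) : signature ⁻¹' {t} ∈ B := by
    rw [fiber_eq]
    refine BooleanSubalgebra.iInf_mem fun i => ?_
    split_ifs
    exacts [hK i, BooleanSubalgebra.compl_mem (hK i)]
  have s_eq : s = ⨆ t : signature '' s, signature ⁻¹' {t.1} := by
    ext y
    simp only [Set.iSup_eq_iUnion, Set.mem_iUnion, Set.mem_preimage, Set.mem_singleton_iff]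
    refine ⟨fun hy => ⟨⟨_, y, hy, rfl⟩, rfl⟩, ?_⟩
    rintro ⟨⟨_, x, hx, rfl⟩, hxy⟩
    exact hs x y (fun i => (Set.ext_iff.1 hxy i).symm) hx
  rw [s_eq]
  exact BooleanSubalgebra.iSup_mem fun t => fiber_mem t

theorem suffix_append_iff {s x y : List α} :
    s <:+ x ++ y ↔ s <:+ y ∨ ∃ t, t <:+ x ∧ t ++ y = s := by
  constructor
  · intro h
    rcases List.suffix_or_suffix_of_suffix h (List.suffix_append x y) with hsy | ⟨t, rfl⟩
    · exact .inl hsy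
    · obtain ⟨r, hr⟩ := h
      exact .inr ⟨t, ⟨r, List.append_cancel_right ((List.append_assoc r t y).trans hr)⟩, rfl⟩
  · rintro (h | ⟨t, ⟨r, rfl⟩, rfl⟩)
    · exact h.trans (List.suffix_append x y)
    · exact ⟨r, (List.append_assoc r t y).symm⟩

theorem exists_append_eq_of_le_length {w : List α} {k : ℕ} (hk : k ≤ w.length) :
    ∃ x u, u.length = k ∧ x ++ u = w :=
  ⟨w.take (w.length - k), w.drop (w.length - k), by simp; omega, List.take_append_drop _ _⟩

theorem eq_or_exists_common_suffix {k : ℕ} {w w' : List α}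
    (h : ∀ u : List α, u.length ≤ k → (u <:+ w ↔ u <:+ w')) :
    w = w' ∨ ∃ x y u, u.length = k ∧ x ++ u = w ∧ y ++ u = w' := by
  rcases le_or_gt k w.length with hk | hk
  · obtain ⟨x, u, hu, rfl⟩ := exists_append_eq_of_le_length hk
    obtain ⟨y, hy⟩ := (h u hu.le).1 (List.suffix_append x u)
    exact .inr ⟨x, y, u, hu, rfl, hy⟩
  · have hww' : w <:+ w' := (h w hk.le).1 (List.suffix_refl w)
    obtain ⟨y, u, hu, hyu⟩ := exists_append_eq_of_le_length (min_le_left w'.length k)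
    have huw : u <:+ w := (h u (by omega)).2 ⟨y, hyu⟩
    have hlen := huw.length_le
    exact .inl (hww'.eq_of_length_le (by omega))

theorem mem_top_mul_iff {K : Language α} {w : List α} :
    w ∈ (⊤ : Language α) * K ↔ ∃ y ∈ K, y <:+ w := by
  rw [Language.mem_mul]
  constructor
  · rintro ⟨x, -, y, hy, rfl⟩
    exact ⟨y, hy, List.suffix_append x y⟩
  · rintro ⟨y, hy, x, rfl⟩
    exact ⟨x, Set.mem_univ x, y, hy, rfl⟩

theorem mem_top_mul_singleton_iff {u w : List α} :
    w ∈ (⊤ : Language α) * ({u} : Language α) ↔ u <:+ w := by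
  rw [mem_top_mul_iff]
  exact ⟨fun ⟨y, hy, hyw⟩ => (show y = u from hy) ▸ hyw, fun h => ⟨u, rfl, h⟩⟩

/-- The right quotient of `L` by `w`, the mirror image of `Language.leftQuotient`. The right
quotients of a regular language are the states of its minimal automaton reading words from right
to left, which is the reading direction suited to languages described by suffixes. -/
def rightQuotient (L : Language α) (w : List α) : Language α := {s | s ++ w ∈ L}

variable {L K : Language α}

theorem mem_rightQuotient {s w : List α} : s ∈ rightQuotient L w ↔ s ++ w ∈ L := Iff.rfl

theorem rightQuotient_nil : rightQuotient L [] = L := by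
  ext s
  rw [mem_rightQuotient, List.append_nil]

theorem rightQuotient_append (x y : List α) :
    rightQuotient L (x ++ y) = rightQuotient (rightQuotient L y) x := by
  ext s
  simp only [mem_rightQuotient, List.append_assoc]

theorem rightQuotient_flatten_eq_self {l : List (List α)} (h : ∀ z ∈ l, rightQuotient L z = L) :
    rightQuotient L l.flatten = L := by
  induction l with
  | nil => exact rightQuotient_nil
  | cons z l ih =>
    rw [List.forall_mem_cons] at h
    rw [List.flatten_cons, rightQuotient_append, ih h.2, h.1]

theorem rightQuotient_flatten_replicate_append {z w : List α}
    (h : rightQuotient L (z ++ w) = rightQuotient L w) (m : ℕ) :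
    rightQuotient L ((List.replicate m z).flatten ++ w) = rightQuotient L w := by
  rw [rightQuotient_append] at h ⊢
  exact rightQuotient_flatten_eq_self fun y hy => List.eq_of_mem_replicate hy ▸ h

theorem isRegular_iff_finite_range_rightQuotient :
    L.IsRegular ↔ (Set.range (rightQuotient L)).Finite := by
  have hrange : Set.range (rightQuotient L) =
      Language.reverse '' Set.range L.reverse.leftQuotient := by
    rw [← Set.range_comp, ← List.reverse_surjective.range_comp]
    congr 1
    ext w s
    simp [mem_rightQuotient]
  rw [hrange, Set.finite_image_iff Language.reverse_injective.injOn,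
    ← Language.isRegular_iff_finite_range_leftQuotient, Language.isRegular_reverse_iff]

theorem isRegular_of_rightQuotient_eq {S : Type*} {f : List α → S} (hf : (Set.range f).Finite)
    (h : ∀ x x', f x = f x' → rightQuotient L x = rightQuotient L x') : L.IsRegular := by
  rw [isRegular_iff_finite_range_rightQuotient]
  obtain ⟨g, hg⟩ := Function.factorsThrough_iff (rightQuotient L) |>.1 fun x x' => h x x'
  rw [hg, Set.range_comp]
  exact hf.image g

theorem isRegular_singleton (u : List α) : Language.IsRegular ({u} : Language α) := by
  have hfin : {t | t <+: u}.Finite := by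
    simpa only [List.mem_inits] using u.inits.finite_toSet
  refine isRegular_iff_finite_range_rightQuotient.2 (hfin.finite_subsets.subset ?_)
  rintro _ ⟨x, rfl⟩ t (rfl : t ++ x = u)
  exact List.prefix_append t x

theorem isRegular_top_mul (hK : K.IsRegular) : ((⊤ : Language α) * K).IsRegular := by
  rw [isRegular_iff_finite_range_rightQuotient] at hK
  refine isRegular_of_rightQuotient_eq (f := fun x => (rightQuotient K x, ∃ s ∈ K, s <:+ x))
    ((hK.prod Set.finite_univ).subset ?_) fun x x' h => ?_
  · rintro _ ⟨x, rfl⟩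
    exact ⟨⟨x, rfl⟩, trivial⟩
  · have key (z y : List α) : y ∈ rightQuotient ((⊤ : Language α) * K) z ↔
        (∃ s ∈ K, s <:+ z) ∨ ∃ t ∈ rightQuotient K z, t <:+ y := by
      rw [mem_rightQuotient, mem_top_mul_iff]
      simp only [suffix_append_iff, and_or_left, exists_or]
      refine or_congr_right ⟨?_, fun ⟨t, ht, hty⟩ => ⟨t ++ z, ht, t, hty, rfl⟩⟩
      rintro ⟨_, hs, t, hty, rfl⟩
      exact ⟨t, hs, hty⟩
    obtain ⟨hquot, hsuffix⟩ := Prod.mk.inj h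
    ext y
    rw [key, key, hquot, hsuffix]

theorem setOf_length_natCast_eq_mem_regularLength {N : ℕ} [NeZero N] (r : ZMod N) :
    ({w : List α | (w.length : ZMod N) = r} : Language α) ∈ RegularLength α := by
  refine ⟨isRegular_of_rightQuotient_eq (f := fun x => (x.length : ZMod N)) (Set.toFinite _)
    fun x x' h => ?_, fun n => ?_⟩
  · ext y
    change ((y ++ x).length : ZMod N) = r ↔ ((y ++ x').length : ZMod N) = r
    simp only [List.length_append, Nat.cast_add, h]
  · by_cases h : (n : ZMod N) = r
    · exact .inl fun w hw => by subst hw; exact h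
    · exact .inr fun w hw => by subst hw; exact h

theorem setOf_exists_mem_length_eq_mem_regularLength (hK : K.IsRegular) :
    ({w : List α | ∃ x ∈ K, x.length = w.length} : Language α) ∈ RegularLength α := by
  rw [isRegular_iff_finite_range_rightQuotient] at hK
  refine ⟨isRegular_of_rightQuotient_eq
    (f := fun x => rightQuotient K '' {x' | x'.length = x.length})
    (hK.finite_subsets.subset ?_) fun x x' h => ?_, fun n => ?_⟩
  · rintro _ ⟨x, rfl⟩
    exact Set.image_subset_range _ _
  · have key (x y : List α) :
        y ∈ rightQuotient {w : List α | ∃ v ∈ K, v.length = w.length} x ↔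
          ∃ J ∈ rightQuotient K '' {x' | x'.length = x.length}, ∃ s ∈ J, s.length = y.length := by
      rw [Set.exists_mem_image]
      constructor
      · rintro ⟨v, hv, hlen⟩
        rw [List.length_append] at hlen
        obtain ⟨s, x', hx', rfl⟩ :=
          exists_append_eq_of_le_length (w := v) (k := x.length) (by omega)
        exact ⟨x', hx', s, hv, by simp at hlen; omega⟩
      · rintro ⟨x', hx' : x'.length = x.length, s, hs, hlen⟩
        exact ⟨s ++ x', hs, by simp [hx', hlen]⟩
    ext y
    rw [key, key, h]
  · by_cases h : ∃ x ∈ K, x.length = n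
    · exact .inl fun w hw => by subst hw; exact h
    · exact .inr fun w hw => by subst hw; exact h

end Languages

section StructureTheorems

variable {α : Type*} {L : Language α}

theorem exists_common_loop_length {S : Set (Language α)} (hS : S.Finite) :
    ∃ N ≠ 0, ∀ q ∈ S, (∃ u ≠ [], rightQuotient q u = q) →
      ∀ c, ∃ x : List α, x.length = c * N ∧ rightQuotient q x = q := by
  induction S, hS using Set.Finite.induction_on with
  | empty => exact ⟨1, one_ne_zero, fun q hq => hq.elim⟩
  | @insert q S _ _ ih =>
    obtain ⟨N, hN, ih⟩ := ih
    by_cases hq : ∃ u ≠ [], rightQuotient q u = q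
    · obtain ⟨u, hu, huq⟩ := hq
      refine ⟨N * u.length, mul_ne_zero hN (by simpa using hu), ?_⟩
      rintro p (rfl | hp) hloop c
      · exact ⟨(List.replicate (c * N) u).flatten, by simp [mul_assoc],
          rightQuotient_flatten_eq_self fun z hz => List.eq_of_mem_replicate hz ▸ huq⟩
      · obtain ⟨x, hx, hxp⟩ := ih p hp hloop (c * u.length)
        exact ⟨x, by rw [hx]; ring, hxp⟩
    · refine ⟨N, hN, ?_⟩
      rintro p (rfl | hp) hloop
      exacts [absurd hloop hq, ih p hp hloop]

/-- A language is well-behaved if, in the automaton of its right quotients, two words of equal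
length that lead from a reachable state into the strongly connected component of that state are
both accepted or both rejected. -/
def WellBehaved (L : Language α) : Prop :=
  ∀ z u v s t : List α, u.length = v.length →
    rightQuotient L (s ++ u ++ z) = rightQuotient L z →
    rightQuotient L (t ++ v ++ z) = rightQuotient L z → u ++ z ∈ L → v ++ z ∈ L

theorem WellBehaved.append_mem_of_natCast_length_eq (h : WellBehaved L) {N : ℕ}
    (hN : ∀ q ∈ Set.range (rightQuotient L), (∃ u ≠ [], rightQuotient q u = q) →
      ∀ c, ∃ x : List α, x.length = c * N ∧ rightQuotient q x = q)
    {x t y : List α} (hx : (x.length : ZMod N) = 0)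
    (hloop : rightQuotient L (t ++ x ++ y) = rightQuotient L y) (hy : y ∈ L) : x ++ y ∈ L := by
  rcases eq_or_ne x [] with rfl | hx0
  · exact hy
  obtain ⟨c, hc⟩ := (ZMod.natCast_eq_zero_iff _ _).1 hx
  obtain ⟨v, hv, hvy⟩ := hN _ ⟨y, rfl⟩
    ⟨t ++ x, by simp [hx0], by rw [← rightQuotient_append, hloop]⟩ c
  rw [← rightQuotient_append] at hvy
  refine h y v x [] t (by rw [hv, hc, mul_comm]) hvy hloop ?_
  rw [← List.nil_append (v ++ y), ← mem_rightQuotient, hvy]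
  exact hy

theorem isRegular_setOf_rightQuotient_eq_and_natCast_length_eq (hL : L.IsRegular) (J : Language α)
    {N : ℕ} [NeZero N] (r : ZMod N) :
    Language.IsRegular {w : List α | rightQuotient L w = J ∧ (w.length : ZMod N) = r} := by
  refine isRegular_of_rightQuotient_eq (f := fun w => (rightQuotient L w, (w.length : ZMod N)))
    (((isRegular_iff_finite_range_rightQuotient.1 hL).prod Set.finite_univ).subset ?_)
    fun x x' h => ?_
  · rintro _ ⟨w, rfl⟩
    exact ⟨⟨w, rfl⟩, trivial⟩
  · obtain ⟨hquot, hlen⟩ := Prod.mk.inj h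
    ext y
    change _ ∧ ((y ++ x).length : ZMod N) = r ↔ _ ∧ ((y ++ x').length : ZMod N) = r
    simp only [rightQuotient_append, hquot, List.length_append, Nat.cast_add, hlen]

theorem WellBehaved.mem_LILen (h : WellBehaved L) (hL : L.IsRegular) : L ∈ LILen α := by
  have hfin := isRegular_iff_finite_range_rightQuotient.1 hL
  obtain ⟨N, hN0, hN⟩ := exists_common_loop_length hfin
  have : NeZero N := ⟨hN0⟩
  have : Finite (Set.range (rightQuotient L)) := hfin
  let V (J : Language α) (r : ZMod N) : Language α :=
    {y | rightQuotient L y = J ∧ (y.length : ZMod N) = r}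
  -- Words that agree on the ideals `Σ* V J r` and in length mod `N` reach states of the same
  -- strongly connected component.
  refine mem_booleanSubalgebra_of_separating
    (BooleanSubalgebra.closure (RegularLeftIdeal α ∪ RegularLength α))
    (K := Sum.elim (fun q : Set.range (rightQuotient L) × ZMod N => (⊤ : Language α) * V q.1 q.2)
      (fun r : ZMod N => {w : List α | (w.length : ZMod N) = r})) ?_ fun w w' hww' hw => ?_
  · rintro (q | r)
    · exact BooleanSubalgebra.mem_closure_of_mem
        (.inl ⟨V q.1 q.2, isRegular_setOf_rightQuotient_eq_and_natCast_length_eq hL q.1 q.2, rfl⟩)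
    · exact BooleanSubalgebra.mem_closure_of_mem
        (.inr (setOf_length_natCast_eq_mem_regularLength r))
  · have hideal (w₀) : (∃ y ∈ V (rightQuotient L w₀) w₀.length, y <:+ w) ↔
        ∃ y ∈ V (rightQuotient L w₀) w₀.length, y <:+ w' := by
      rw [← mem_top_mul_iff, ← mem_top_mul_iff]
      exact hww' (.inl (⟨_, w₀, rfl⟩, w₀.length))
    have hlen : (w'.length : ZMod N) = w.length := (hww' (.inr w.length)).1 rfl
    obtain ⟨y, ⟨hyq, hyr⟩, x, rfl⟩ := (hideal w).1 ⟨w, ⟨rfl, rfl⟩, List.suffix_refl w⟩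
    obtain ⟨y', ⟨hyq', -⟩, x', rfl⟩ :=
      (hideal (x ++ y)).2 ⟨x ++ y, ⟨rfl, rfl⟩, List.suffix_refl _⟩
    refine h.append_mem_of_natCast_length_eq hN (x := x) (t := x') (y := y) ?_ ?_ ?_
    · simpa [hyr] using hlen
    · rw [List.append_assoc, rightQuotient_append, ← hyq', ← rightQuotient_append, hyq]
    · rw [← List.nil_append y, ← mem_rightQuotient, hyq, mem_rightQuotient]
      exact hw

/-- The concatenation of the words `X` (for `true`) and `Y` (for `false`) chosen by `bs`. -/
def blocks (X Y : List α) (bs : List Bool) : List α :=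
  (bs.map fun b => cond b X Y).flatten

theorem blocks_append (X Y : List α) (bs bs' : List Bool) :
    blocks X Y (bs ++ bs') = blocks X Y bs ++ blocks X Y bs' := by
  simp [blocks]

theorem length_blocks {X Y : List α} (h : X.length = Y.length) (bs : List Bool) :
    (blocks X Y bs).length = bs.length * X.length := by
  induction bs with
  | nil => simp [blocks]
  | cons b bs ih =>
    have hb : (cond b X Y).length = X.length := by cases b <;> simp [h]
    simp_all only [blocks, List.map_cons, List.flatten_cons, List.length_append, List.length_cons]
    ring

theorem exists_blocks_of_notMem_LILen (hL : L.IsRegular) (h : L ∉ LILen α) :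
    ∃ X Y u v z : List α, X.length = Y.length ∧ u.length = v.length ∧ u <:+ X ∧ v <:+ Y ∧
      ∀ bs, u ++ (blocks X Y bs ++ z) ∈ L ∧ v ++ (blocks X Y bs ++ z) ∉ L := by
  have h' : ¬ WellBehaved L := fun hwb => h (hwb.mem_LILen hL)
  simp only [WellBehaved, not_forall] at h'
  obtain ⟨z, u, v, s, t, huv, hu, hv, huL, hvL⟩ := h'
  have hloop (l : List (List α)) (hl : ∀ x ∈ l, x = s ++ u ∨ x = t ++ v) :
      rightQuotient (rightQuotient L z) l.flatten = rightQuotient L z :=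
    rightQuotient_flatten_eq_self fun x hx => by
      rcases hl x hx with rfl | rfl
      exacts [(rightQuotient_append _ z).symm.trans hu, (rightQuotient_append _ z).symm.trans hv]
  refine ⟨[t ++ v, s ++ u].flatten, [s ++ u, t ++ v].flatten, u, v, z, by simp; omega, huv,
    ⟨t ++ v ++ s, by simp⟩, ⟨s ++ u ++ t, by simp⟩, fun bs => ?_⟩
  have hblocks : rightQuotient L
      (blocks [t ++ v, s ++ u].flatten [s ++ u, t ++ v].flatten bs ++ z) = rightQuotient L z := by
    rw [rightQuotient_append]
    refine rightQuotient_flatten_eq_self fun x hx => ?_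
    obtain ⟨b, -, rfl⟩ := List.mem_map.1 hx
    cases b <;> exact hloop _ (by simp)
  rw [← mem_rightQuotient, ← mem_rightQuotient, hblocks]
  exact ⟨huL, hvL⟩

theorem mem_STLen_of_suffix_determined [Finite α] (hL : L.IsRegular) (k : ℕ)
    (h : ∀ x y u : List α, x.length = y.length → u.length = k → x ++ u ∈ L → y ++ u ∈ L) :
    L ∈ STLen α := by
  have : Finite {u : List α // u.length ≤ k} := List.finite_length_le α k
  refine mem_booleanSubalgebra_of_separating
    (BooleanSubalgebra.closure (SuffixTestable α ∪ RegularLength α))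
    (K := Sum.elim (fun u : {u : List α // u.length ≤ k} => (⊤ : Language α) * {u.1})
      (fun u : {u : List α // u.length ≤ k} =>
        {w | ∃ x ∈ L ⊓ (⊤ : Language α) * {u.1}, x.length = w.length})) ?_ fun w w' hww' hw => ?_
  · rintro (u | u)
    · exact BooleanSubalgebra.mem_closure_of_mem
        (.inl (BooleanSubalgebra.mem_closure_of_mem ⟨u.1, rfl⟩))
    · exact BooleanSubalgebra.mem_closure_of_mem (.inr
        (setOf_exists_mem_length_eq_mem_regularLength
          (hL.inf (isRegular_top_mul (isRegular_singleton u.1)))))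
  · have hsuffix (u : List α) (hu : u.length ≤ k) : u <:+ w ↔ u <:+ w' := by
      rw [← mem_top_mul_singleton_iff, ← mem_top_mul_singleton_iff]
      exact hww' (.inl ⟨u, hu⟩)
    obtain rfl | ⟨x, y, u, hu, rfl, rfl⟩ := eq_or_exists_common_suffix hsuffix
    · exact hw
    · obtain ⟨v, ⟨hvL, hvu⟩, hlen⟩ := (hww' (.inr ⟨u, hu.le⟩)).1
        ⟨x ++ u, ⟨hw, mem_top_mul_singleton_iff.2 (List.suffix_append x u)⟩, rfl⟩
      obtain ⟨x', rfl⟩ := mem_top_mul_singleton_iff.1 hvu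
      exact h x' y u (by simpa using hlen) hu hvL

theorem exists_rightQuotient_loop (hL : L.IsRegular) :
    ∃ k, ∀ u : List α, u.length = k →
      ∃ c b a, u = c ++ (b ++ a) ∧ b ≠ [] ∧ rightQuotient L (b ++ a) = rightQuotient L a := by
  have hfin := isRegular_iff_finite_range_rightQuotient.1 hL
  have := hfin.fintype
  refine ⟨Fintype.card (Set.range (rightQuotient L)), fun u hu => ?_⟩
  obtain ⟨i, j, hij, heq⟩ := Fintype.exists_ne_map_eq_of_card_lt
    (fun i : Fin (u.length + 1) => (⟨_, u.drop i, rfl⟩ : Set.range (rightQuotient L)))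
    (by simp [hu])
  wlog hlt : i < j generalizing i j
  · exact this j i hij.symm heq.symm (lt_of_le_of_ne (not_lt.1 hlt) hij.symm)
  have hdrop : u.drop i = (u.drop i).take (j - i) ++ u.drop j := by
    conv_lhs => rw [← List.take_append_drop (j - i) (u.drop i), List.drop_drop]
    congr 2
    omega
  refine ⟨u.take i, (u.drop i).take (j - i), u.drop j, ?_, ?_, ?_⟩
  · rw [← hdrop, List.take_append_drop]
  · rw [ne_eq, ← List.length_eq_zero_iff, List.length_take, List.length_drop]
    omega
  · rw [← hdrop]
    exact Subtype.mk.inj heq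

theorem exists_pumping_of_notMem_STLen [Finite α] (hL : L.IsRegular) (h : L ∉ STLen α) :
    ∃ x y z w : List α, x.length = y.length ∧ z ≠ [] ∧ x.length ≤ z.length ∧
      x ++ w ∈ L ∧ y ++ w ∉ L ∧ rightQuotient L (z ++ w) = rightQuotient L w := by
  obtain ⟨k, hk⟩ := exists_rightQuotient_loop hL
  obtain ⟨x, y, u, hxy, hu, hx, hy⟩ : ∃ x y u : List α, x.length = y.length ∧ u.length = k ∧
      x ++ u ∈ L ∧ y ++ u ∉ L := by
    by_contra! hdet
    exact h (mem_STLen_of_suffix_determined hL k hdet)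
  obtain ⟨c, b, a, rfl, hb, hba⟩ := hk u hu
  rw [← List.append_assoc, ← mem_rightQuotient, hba] at hx hy
  have hb_pos : 0 < b.length := List.length_pos_iff.2 hb
  refine ⟨x ++ c, y ++ c, (List.replicate ((x ++ c).length + 1) b).flatten, a, by simp [hxy],
    by simp [List.replicate_succ, hb], ?_, hx, hy, ?_⟩
  · simp only [List.length_flatten, List.map_replicate, List.sum_replicate, smul_eq_mul]
    nlinarith
  · exact rightQuotient_flatten_replicate_append hba _

end StructureTheorems

section Walks

variable {Q : Type*} {R : Q → Q → Prop}

variable (R) in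
/-- `Walk R n p q` means that there is a walk of length `n` from `p` to `q` in the directed graph
with edge relation `R`. -/
def Walk : ℕ → Q → Q → Prop
  | 0, p, q => p = q
  | n + 1, p, q => ∃ r, Walk n p r ∧ R r q

theorem Walk.append {m n : ℕ} {p q r : Q} (h₁ : Walk R m p q) (h₂ : Walk R n q r) :
    Walk R (m + n) p r := by
  induction n generalizing r with
  | zero => exact (show q = r from h₂) ▸ h₁
  | succ n ih =>
    obtain ⟨s, hs, hr⟩ := h₂
    exact ⟨s, ih hs, hr⟩

theorem Walk.pow {n : ℕ} {p : Q} (h : Walk R n p p) (t : ℕ) : Walk R (t * n) p p := by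
  induction t with
  | zero => rw [Nat.zero_mul]; exact rfl
  | succ t ih => rw [Nat.succ_mul]; exact ih.append h

theorem Walk.exists_path {n : ℕ} {p q : Q} (h : Walk R n p q) :
    ∃ f : ℕ → Q, f 0 = p ∧ f n = q ∧ ∀ i < n, R (f i) (f (i + 1)) := by
  induction n generalizing q with
  | zero => exact ⟨fun _ => p, rfl, h, fun i hi => absurd hi i.not_lt_zero⟩
  | succ n ih =>
    obtain ⟨r, hr, hrq⟩ := h
    obtain ⟨f, h0, hn, hf⟩ := ih hr
    refine ⟨fun i => if i ≤ n then f i else q, by simpa using h0, by simp, fun i hi => ?_⟩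
    rcases (Nat.lt_succ_iff.1 hi).lt_or_eq with hin | rfl
    · simpa [hin.le, Nat.succ_le_of_lt hin] using hf i hin
    · simpa [hn] using hrq

theorem walk_of_path {f : ℕ → Q} {n i d : ℕ} (hf : ∀ i < n, R (f i) (f (i + 1)))
    (h : i + d ≤ n) : Walk R d (f i) (f (i + d)) := by
  induction d with
  | zero => exact rfl
  | succ d ih => exact ⟨_, ih (by omega), hf _ (by omega)⟩

theorem Walk.exists_split {X : Type*} [Fintype X] (c : ℕ → Q → X) {n : ℕ} {p q : Q}
    (h : Walk R n p q) (hn : Fintype.card X ≤ n) :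
    ∃ i d j u v, i + d + j = n ∧ 0 < d ∧ i + d ≤ Fintype.card X ∧ c i u = c (i + d) v ∧
      Walk R i p u ∧ Walk R d u v ∧ Walk R j v q := by
  obtain ⟨f, rfl, rfl, hf⟩ := h.exists_path
  obtain ⟨i, i', hne, hc⟩ := Fintype.exists_ne_map_eq_of_card_lt
    (fun i : Fin (Fintype.card X + 1) => c i (f i)) (by simp)
  wlog hlt : i < i' generalizing i i'
  · exact this i' i hne.symm hc.symm (lt_of_le_of_ne (not_lt.1 hlt) hne.symm)
  obtain ⟨d, hd⟩ := Nat.exists_eq_add_of_le (Fin.le_iff_val_le_val.1 hlt.le)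
  obtain ⟨j, rfl⟩ := Nat.exists_eq_add_of_le (show i + d ≤ n by omega)
  refine ⟨i, d, j, f i, f (i + d), rfl, ?_, by omega, by simpa only [hd] using hc, ?_,
    walk_of_path hf (by omega), walk_of_path hf le_rfl⟩
  · rw [Fin.lt_def] at hlt
    omega
  · simpa using walk_of_path (i := 0) (d := i) hf (by omega)

variable [Fintype Q]

theorem Walk.exists_cycle {n : ℕ} {p q : Q} (h : Walk R n p q) (hn : Fintype.card Q ≤ n) :
    ∃ i d j v, i + d + j = n ∧ 0 < d ∧ d ≤ Fintype.card Q ∧ Walk R i p v ∧ Walk R d v v ∧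
      Walk R j v q := by
  obtain ⟨i, d, j, u, v, rfl, hd, hid, rfl, h₁, h₂, h₃⟩ := h.exists_split (fun _ v => v) hn
  exact ⟨i, d, j, u, rfl, hd, by omega, h₁, h₂, h₃⟩

theorem Walk.exists_longer {n : ℕ} {p q : Q} (h : Walk R n p q) (hn : Fintype.card Q ≤ n) :
    ∃ b > n, Walk R b p q := by
  obtain ⟨i, d, j, v, rfl, hd, -, h₁, h₂, h₃⟩ := h.exists_cycle hn
  exact ⟨i + d + d + j, by omega, ((h₁.append h₂).append h₂).append h₃⟩

theorem Walk.exists_short_modEq {d : ℕ} (hd : 0 < d) {n : ℕ} {p q : Q} (h : Walk R n p q) :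
    ∃ n' ≤ Fintype.card Q * d, n' ≡ n [MOD d] ∧ Walk R n' p q := by
  induction n using Nat.strong_induction_on with
  | _ n ih =>
    rcases le_or_gt n (Fintype.card Q * d) with hn | hn
    · exact ⟨n, hn, rfl, h⟩
    obtain ⟨i, e, j, u, v, rfl, he, -, hc, h₁, -, h₃⟩ :=
      h.exists_split (fun i v => (v, (⟨i % d, Nat.mod_lt i hd⟩ : Fin d)))
        (by simpa using hn.le)
    obtain ⟨rfl, hmod⟩ := Prod.mk.inj hc
    obtain ⟨n', hn', hmod', hw⟩ := ih (i + j) (by omega) (h₁.append h₃)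
    exact ⟨n', hn', hmod'.trans (Nat.ModEq.add_right j (Fin.mk.inj hmod)), hw⟩

theorem Walk.of_add_mul_factorial {m t : ℕ} {p q : Q} (hm : 2 * Fintype.card Q ^ 2 ≤ m)
    (h : Walk R (m + t * (Fintype.card Q).factorial) p q) : Walk R m p q := by
  have hcard : Fintype.card Q ≤ m := by nlinarith [Nat.le_self_pow two_ne_zero (Fintype.card Q)]
  obtain ⟨i, d, j, v, hlen, hd, hdQ, h₁, h₂, h₃⟩ := h.exists_cycle (by omega)
  obtain ⟨i', hi', hi'i, h₁'⟩ := h₁.exists_short_modEq hd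
  obtain ⟨j', hj', hj'j, h₃'⟩ := h₃.exists_short_modEq hd
  have hle : i' + j' ≤ m := by nlinarith
  have hmod : i' + j' ≡ m [MOD d] := calc
    i' + j' ≡ i + j [MOD d] := hi'i.add hj'j
    _ ≡ i + j + d [MOD d] := Nat.add_modEq_right.symm
    _ = m + t * (Fintype.card Q).factorial := by omega
    _ ≡ m [MOD d] := by
      simpa using (Nat.modEq_zero_iff_dvd.2 ((Nat.dvd_factorial hd hdQ).mul_left t)).add_left m
  obtain ⟨c, hc⟩ := (Nat.modEq_iff_dvd' hle).1 hmod
  obtain rfl : i' + c * d + j' = m := by rw [mul_comm c d]; omega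
  exact (h₁'.append (h₂.pow c)).append h₃'

end Walks

section NFAPumping

variable {α Q : Type*} (P : NFA α Q)

theorem mem_evalFrom_flatten_replicate (z : List α) (b : ℕ) (S : Set Q) (q : Q) :
    q ∈ P.evalFrom S (List.replicate b z).flatten ↔
      ∃ p ∈ S, Walk (fun p q => q ∈ P.evalFrom {p} z) b p q := by
  induction b generalizing q with
  | zero => simp [Walk]
  | succ b ih =>
    rw [List.replicate_succ', List.flatten_append, List.flatten_singleton, NFA.evalFrom_append,
      NFA.mem_evalFrom_iff_exists]
    simp only [ih, Walk]
    tauto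

theorem append_flatten_replicate_mem_accepts_iff (x z w : List α) (b : ℕ) :
    x ++ ((List.replicate b z).flatten ++ w) ∈ P.accepts ↔
      ∃ p ∈ P.evalFrom P.start x, ∃ q, Walk (fun p q => q ∈ P.evalFrom {p} z) b p q ∧
        w ∈ P.acceptsFrom {q} := by
  rw [NFA.accepts_eq_acceptsFrom_start, NFA.append_mem_acceptsFrom, NFA.append_mem_acceptsFrom,
    NFA.mem_acceptsFrom]
  simp only [NFA.mem_acceptsFrom]
  constructor
  · rintro ⟨s, hs, hws⟩
    obtain ⟨q, hq, hqs⟩ := (P.mem_evalFrom_iff_exists).1 hws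
    obtain ⟨p, hp, hpq⟩ := (mem_evalFrom_flatten_replicate P z b _ q).1 hq
    exact ⟨p, hp, q, hpq, s, hs, hqs⟩
  · rintro ⟨p, hp, q, hpq, s, hs, hqs⟩
    exact ⟨s, hs, (P.mem_evalFrom_iff_exists).2
      ⟨q, (mem_evalFrom_flatten_replicate P z b _ q).2 ⟨p, hp, hpq⟩, hqs⟩⟩

variable {P} [Fintype Q] {x z w : List α} {m : ℕ}

theorem append_flatten_replicate_mem_accepts_of_add_mul_factorial {t : ℕ}
    (hm : 2 * Fintype.card Q ^ 2 ≤ m)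
    (h : x ++ ((List.replicate (m + t * (Fintype.card Q).factorial) z).flatten ++ w) ∈ P.accepts) :
    x ++ ((List.replicate m z).flatten ++ w) ∈ P.accepts := by
  rw [append_flatten_replicate_mem_accepts_iff] at h ⊢
  obtain ⟨p, hp, q, hpq, hq⟩ := h
  exact ⟨p, hp, q, hpq.of_add_mul_factorial hm, hq⟩

theorem exists_append_flatten_replicate_mem_accepts_gt (hm : Fintype.card Q ≤ m)
    (h : x ++ ((List.replicate m z).flatten ++ w) ∈ P.accepts) :
    ∃ b > m, x ++ ((List.replicate b z).flatten ++ w) ∈ P.accepts := by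
  simp only [append_flatten_replicate_mem_accepts_iff] at h ⊢
  obtain ⟨p, hp, q, hpq, hq⟩ := h
  obtain ⟨b, hb, hpq'⟩ := hpq.exists_longer hm
  exact ⟨b, hb, p, hp, q, hpq', hq⟩

end NFAPumping

section WindowPumping

variable {α : Type*} {pad : α} {L : Language α}

theorem append_mem_SW_iff {n : ℕ} {u v : List α} (h : v.length = n) :
    u ++ v ∈ SW pad L n ↔ v ∈ L := by
  subst h
  change lastWindow pad v.length (u ++ v) ∈ L ↔ v ∈ L
  simp [lastWindow]

theorem append_flatten_replicate_append_mem_SW_iff {z w u v : List α}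
    (h : rightQuotient L (z ++ w) = rightQuotient L w) (m : ℕ) :
    u ++ (v ++ ((List.replicate m z).flatten ++ w)) ∈
      SW pad L (v.length + (w.length + m * z.length)) ↔ v ++ w ∈ L := by
  rw [append_mem_SW_iff (by simp; omega), ← mem_rightQuotient,
    rightQuotient_flatten_replicate_append h, mem_rightQuotient]

theorem append_flatten_replicate_mem_SW_iff_of_lt {z' z'' w u : List α}
    (h : rightQuotient L (z' ++ z'' ++ w) = rightQuotient L w) {m b : ℕ} (hmb : m < b) :
    u ++ ((List.replicate b (z' ++ z'')).flatten ++ w) ∈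
      SW pad L (z''.length + (w.length + m * (z' ++ z'').length)) ↔ z'' ++ w ∈ L := by
  obtain ⟨t, rfl⟩ := Nat.exists_eq_add_of_lt hmb
  rw [← append_flatten_replicate_append_mem_SW_iff (pad := pad)
    (u := u ++ ((List.replicate t (z' ++ z'')).flatten ++ z')) h m,
    show m + t + 1 = t + 1 + m by omega, List.replicate_add, List.replicate_succ']
  simp

theorem lt_two_mul_card_sq_of_accepts_eq_SW {x y z w : List α} (hxy : x.length = y.length)
    (hxz : x.length ≤ z.length) (hx : x ++ w ∈ L) (hy : y ++ w ∉ L)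
    (hzw : rightQuotient L (z ++ w) = rightQuotient L w) {m : ℕ} {Q : Type*} [Finite Q]
    {P : NFA α Q} (hP : P.accepts = SW pad L (x.length + (w.length + m * z.length))) :
    m < 2 * Nat.card Q ^ 2 := by
  have := Fintype.ofFinite Q
  rw [Nat.card_eq_fintype_card]
  by_contra! hm
  obtain ⟨z', z'', hz'', rfl⟩ := exists_append_eq_of_le_length hxz
  have mem_of_lt {u b} (hb : m < b) :
      u ++ ((List.replicate b (z' ++ z'')).flatten ++ w) ∈ P.accepts ↔ z'' ++ w ∈ L := by
    rw [hP, ← hz'']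
    exact append_flatten_replicate_mem_SW_iff_of_lt hzw hb
  have mem_of_length_eq {v : List α} (hv : v.length = x.length) :
      v ++ ((List.replicate m (z' ++ z'')).flatten ++ w) ∈ P.accepts ↔ v ++ w ∈ L := by
    rw [hP, ← hv]
    exact append_flatten_replicate_append_mem_SW_iff (u := []) hzw m
  -- Lengthening the accepting run on `x zᵐ w` forces `z'' w ∈ L`; shortening an accepting run on
  -- `y zᵇ w` then forces `y w ∈ L`.
  have hcard : Fintype.card Q ≤ m := by nlinarith [Nat.le_self_pow two_ne_zero (Fintype.card Q)]
  obtain ⟨b, hb, hbx⟩ :=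
    exists_append_flatten_replicate_mem_accepts_gt hcard ((mem_of_length_eq rfl).2 hx)
  have hmb : m < m + 1 * (Fintype.card Q).factorial := by
    have := Nat.factorial_pos (Fintype.card Q)
    omega
  exact hy ((mem_of_length_eq hxy.symm).1
    (append_flatten_replicate_mem_accepts_of_add_mul_factorial hm
      ((mem_of_lt hmb).2 ((mem_of_lt hb).1 hbx))))

end WindowPumping

namespace RandomizedAlgorithm

variable {α Q : Type*} (P : RandomizedAlgorithm α Q)

/-- The algorithm `P` with initial memory state `p`. -/
noncomputable def startFrom (p : Q) : RandomizedAlgorithm α Q := { P with init := PMF.pure p }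

theorem run_append_singleton (w : List α) (a : α) :
    P.run (w ++ [a]) = (P.run w).bind fun p => P.step p a := by
  simp [run]

theorem run_append (u v : List α) :
    P.run (u ++ v) = (P.run u).bind fun p => (P.startFrom p).run v := by
  induction v using List.reverseRecOn with
  | nil => exact (List.append_nil u).symm ▸ (PMF.bind_pure (P.run u)).symm
  | append_singleton v a ih =>
    simp_rw [← List.append_assoc, run_append_singleton, ih, PMF.bind_bind]
    rfl

theorem acceptProb_append (u v : List α) :
    P.acceptProb (u ++ v) = ∑' p, P.run u p * (P.startFrom p).acceptProb v := by
  rw [acceptProb, run_append, PMF.toOuterMeasure_bind_apply]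
  rfl

theorem acceptProb_le_one (w : List α) : P.acceptProb w ≤ 1 := by
  rw [acceptProb, PMF.toOuterMeasure_apply, ← (P.run w).tsum_coe]
  exact ENNReal.tsum_le_tsum fun p => Set.indicator_le_self _ _ p

theorem acceptProb_append_le (u v : List α) :
    P.acceptProb (u ++ v) ≤
      (P.run u).toOuterMeasure {p | (P.startFrom p).acceptProb v ≠ 0} := by
  rw [acceptProb_append, PMF.toOuterMeasure_apply]
  refine ENNReal.tsum_le_tsum fun p => ?_
  by_cases hp : (P.startFrom p).acceptProb v = 0
  · simp [hp]
  · rw [Set.indicator_of_mem (show p ∈ {p | (P.startFrom p).acceptProb v ≠ 0} from hp)]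
    exact mul_le_of_le_one_right' (acceptProb_le_one _ v)

theorem acceptProb_append_ne_zero {u v : List α} {p : Q} (hp : p ∈ (P.run u).support)
    (hv : (P.startFrom p).acceptProb v ≠ 0) : P.acceptProb (u ++ v) ≠ 0 := by
  rw [acceptProb_append, ne_eq, ENNReal.tsum_eq_zero, not_forall]
  exact ⟨p, mul_ne_zero ((PMF.mem_support_iff _ _).1 hp) hv⟩

theorem rejectProb_eq_one_iff (w : List α) : P.rejectProb w = 1 ↔ P.acceptProb w = 0 := by
  rw [rejectProb, acceptProb, PMF.toOuterMeasure_apply_eq_one_iff,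
    PMF.toOuterMeasure_apply_eq_zero_iff, Set.subset_compl_iff_disjoint_right]

variable {P} in
theorem IsTrueBiasedFor.acceptProb_ne_zero_iff {K : Language α} (h : P.IsTrueBiasedFor K)
    {w : List α} : P.acceptProb w ≠ 0 ↔ w ∈ K := by
  refine ⟨fun hw => ?_, fun hw hw0 => ?_⟩
  · by_contra hwK
    exact hw ((P.rejectProb_eq_one_iff w).1 ((h w).2 hwK))
  · simpa [hw0] using (h w).1 hw

/-- The nondeterministic automaton of all transitions of positive probability. -/
def toNFA : NFA α Q := ⟨fun p a => (P.step p a).support, P.init.support, P.accept⟩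

theorem eval_toNFA (w : List α) : P.toNFA.eval w = (P.run w).support := by
  induction w using List.reverseRecOn with
  | nil => rfl
  | append_singleton w a ih =>
    rw [NFA.eval_append_singleton, ih, run_append_singleton, PMF.support_bind]
    rfl

theorem mem_accepts_toNFA {w : List α} : w ∈ P.toNFA.accepts ↔ P.acceptProb w ≠ 0 := by
  rw [acceptProb, ne_eq, PMF.toOuterMeasure_apply_eq_zero_iff, ← eval_toNFA, Set.not_disjoint_iff]
  exact exists_congr fun _ => and_comm

variable {P} in
theorem IsTrueBiasedFor.accepts_toNFA {K : Language α} (h : P.IsTrueBiasedFor K) :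
    P.toNFA.accepts = K := by
  ext w
  rw [mem_accepts_toNFA, h.acceptProb_ne_zero_iff]

/-- The complementary algorithm, which accepts when `P` rejects. -/
def compl : RandomizedAlgorithm α Q := { P with accept := P.acceptᶜ }

protected theorem compl_compl : P.compl.compl = P := by
  simp only [compl, _root_.compl_compl]

theorem isTrueBiasedFor_compl_iff {K : Language α} :
    P.compl.IsTrueBiasedFor Kᶜ ↔ P.IsFalseBiasedFor K := by
  refine forall_congr' fun w => ?_
  have hreject : P.compl.rejectProb w = P.acceptProb w :=
    congrArg (P.run w).toOuterMeasure (compl_compl P.accept)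
  rw [hreject, and_comm]
  exact and_congr_left' (imp_congr_left not_not)

/-- The deterministic automaton `M` as a randomized algorithm. -/
noncomputable def ofDFA (M : DFA α Q) : RandomizedAlgorithm α Q :=
  ⟨PMF.pure M.start, fun p a => PMF.pure (M.step p a), M.accept⟩

theorem run_ofDFA (M : DFA α Q) (w : List α) : (ofDFA M).run w = PMF.pure (M.eval w) := by
  induction w using List.reverseRecOn with
  | nil => rfl
  | append_singleton w a ih =>
    rw [run_append_singleton, ih, PMF.pure_bind, DFA.eval_append_singleton]
    rfl

theorem isTrueBiasedFor_ofDFA (M : DFA α Q) : (ofDFA M).IsTrueBiasedFor M.accepts := by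
  intro w
  rw [acceptProb, rejectProb, run_ofDFA, PMF.toOuterMeasure_apply_eq_one_iff, PMF.support_pure,
    Set.singleton_subset_iff]
  refine ⟨fun hw => ?_, id⟩
  rw [(PMF.toOuterMeasure_apply_eq_one_iff _ _).2 (by
    rwa [PMF.support_pure, Set.singleton_subset_iff])]
  exact ENNReal.div_le_of_le_mul (by norm_num)

end RandomizedAlgorithm

section IndexProblem

theorem exists_mem_support_sum_toOuterMeasure_le {M ι : Type*} [Fintype ι] (p : PMF M)
    (A : ι → Set M) :
    ∃ m ∈ p.support, ∑ i, p.toOuterMeasure (A i) ≤ (Nat.card {i // m ∈ A i} : ℝ≥0∞) := by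
  classical
  let _ : MeasurableSpace M := ⊤
  have lintegral_eq :
      ∫⁻ m, ∑ i, (A i).indicator 1 m ∂p.toMeasure = ∑ i, p.toOuterMeasure (A i) := by
    rw [MeasureTheory.lintegral_finsetSum _ fun i _ => measurable_from_top]
    refine Finset.sum_congr rfl fun i _ => ?_
    rw [MeasureTheory.lintegral_indicator_one MeasurableSpace.measurableSet_top,
      p.toMeasure_apply_eq_toOuterMeasure_apply MeasurableSpace.measurableSet_top]
  have support_compl_null : p.toMeasure p.supportᶜ = 0 := by
    rw [p.toMeasure_apply_eq_zero_iff MeasurableSpace.measurableSet_top]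
    exact disjoint_compl_right
  have lintegral_ne_top : ∫⁻ m, ∑ i, (A i).indicator 1 m ∂p.toMeasure ≠ ∞ := by
    rw [lintegral_eq, ← lt_top_iff_ne_top, ENNReal.sum_lt_top]
    intro i _
    rw [← p.toMeasure_apply_eq_toOuterMeasure_apply (s := A i)
      MeasurableSpace.measurableSet_top]
    exact MeasureTheory.measure_lt_top _ _
  obtain ⟨m, hm, hle⟩ :=
    MeasureTheory.exists_notMem_null_lintegral_le lintegral_ne_top support_compl_null
  refine ⟨m, not_not.1 hm, (lintegral_eq ▸ hle).trans_eq ?_⟩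
  simp [Set.indicator_apply, Fintype.card_subtype]

theorem card_le_two_pow_card_compl_of_agree {ι : Type*} [Fintype ι] [DecidableEq ι]
    {F : Finset (ι → Bool)} {T : Finset ι} {f₀ : ι → Bool} (h : ∀ f ∈ F, ∀ i ∈ T, f i = f₀ i) :
    F.card ≤ 2 ^ Tᶜ.card := by
  calc F.card ≤ (Finset.univ : Finset (↥Tᶜ → Bool)).card := by
        refine Finset.card_le_card_of_injOn (fun f i => f i) (fun _ _ => Finset.mem_univ _) ?_
        refine fun f hf f' hf' heq => funext fun i => ?_
        by_cases hi : i ∈ T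
        · rw [h f hf i hi, h f' hf' i hi]
        · exact congrFun heq ⟨i, Finset.mem_compl.2 hi⟩
    _ = 2 ^ Tᶜ.card := by simp [Finset.card_compl]

theorem two_pow_le_card_of_decoding {M ι : Type*} [Finite M] [Finite ι] (g : (ι → Bool) → M)
    (S : M → ι → Bool → Prop) (sound : ∀ f i, ¬ S (g f) i (!f i)) {k : ℕ}
    (hk : ∀ f, k ≤ Nat.card {i // S (g f) i (f i)}) : 2 ^ k ≤ Nat.card M := by
  classical
  have := Fintype.ofFinite M
  have := Fintype.ofFinite ι
  simp only [Nat.card_eq_fintype_card, Fintype.card_subtype] at hk ⊢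
  have hkι : k ≤ Fintype.card ι := (hk fun _ => true).trans (Finset.card_le_univ _)
  have fiber_card_le (m : M) :
      (Finset.univ.filter fun f => g f = m).card ≤ 2 ^ (Fintype.card ι - k) := by
    rcases (Finset.univ.filter fun f => g f = m).eq_empty_or_nonempty with hempty | ⟨f₀, hf₀⟩
    · simp [hempty]
    obtain rfl : g f₀ = m := by simpa using hf₀
    refine (card_le_two_pow_card_compl_of_agree (f₀ := f₀)
      (T := Finset.univ.filter fun i => S (g f₀) i (f₀ i)) fun f hf i hi => ?_).trans
      (Nat.pow_le_pow_right two_pos ?_)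
    · rw [Finset.mem_filter] at hf hi
      by_contra hne
      have hnot : (!f i) = f₀ i := (Bool.eq_not.2 (Ne.symm hne)).symm
      exact sound f i (by rw [hf.2, hnot]; exact hi.2)
    · rw [Finset.card_compl]
      exact Nat.sub_le_sub_left (hk f₀) _
  have hcount := Finset.card_le_mul_card_image_of_maps_to (s := Finset.univ)
    (fun f _ => Finset.mem_univ (g f)) _ fun m _ => fiber_card_le m
  rw [Finset.card_univ, Finset.card_univ, Fintype.card_fun, Fintype.card_bool] at hcount
  refine Nat.le_of_mul_le_mul_left ?_ (pow_pos two_pos (Fintype.card ι - k))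
  rwa [← pow_add, Nat.sub_add_cancel hkι]

theorem two_pow_le_card_of_randomized_decoding {M ι : Type*} [Finite M] [Fintype ι]
    (μ : (ι → Bool) → PMF M) (S : M → ι → Bool → Prop)
    (sound : ∀ f i, ∀ m ∈ (μ f).support, ¬ S m i (!f i)) {δ : ℝ≥0∞}
    (complete : ∀ f i, δ ≤ (μ f).toOuterMeasure {m | S m i (f i)}) {k : ℕ}
    (hk : (k : ℝ≥0∞) ≤ Fintype.card ι * δ) : 2 ^ k ≤ Nat.card M := by
  choose g hg hcount using fun f =>
    exists_mem_support_sum_toOuterMeasure_le (μ f) fun i => {m | S m i (f i)}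
  refine two_pow_le_card_of_decoding g S (fun f i => sound f i (g f) (hg f)) fun f => ?_
  have hle : Fintype.card ι * δ ≤ ∑ i, (μ f).toOuterMeasure {m | S m i (f i)} := by
    simpa using Finset.card_nsmul_le_sum Finset.univ _ δ fun i _ => complete f i
  exact Nat.cast_le.1 ((hk.trans hle).trans (hcount f))

theorem append_blocks_append_mem_SW_iff {α : Type*} {pad : α} {L : Language α}
    {X Y u v z : List α} (hXY : X.length = Y.length) (huv : u.length = v.length) (hu : u <:+ X)
    (hv : v <:+ Y)
    (h : ∀ bs, u ++ (blocks X Y bs ++ z) ∈ L ∧ v ++ (blocks X Y bs ++ z) ∉ L) (cs : List Bool)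
    (b : Bool) (ds : List Bool) :
    blocks X Y (cs ++ b :: ds) ++ z ∈ SW pad L (u.length + (ds.length * X.length + z.length)) ↔
      b = true := by
  obtain ⟨x, rfl⟩ := hu
  obtain ⟨y, rfl⟩ := hv
  have hsplit : blocks (x ++ u) (y ++ v) (cs ++ b :: ds) ++ z =
      (blocks (x ++ u) (y ++ v) cs ++ cond b x y) ++
        (cond b u v ++ (blocks (x ++ u) (y ++ v) ds ++ z)) := by
    cases b <;> simp [blocks]
  rw [hsplit, append_mem_SW_iff (by cases b <;> simp [length_blocks hXY, huv])]
  cases b <;> simp [h ds]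

theorem exists_index_words {α : Type*} (pad : α) {L : Language α} (hL : L.IsRegular)
    (h : L ∉ LILen α) :
    ∃ A B, 0 < B ∧ ∀ k, ∃ (data : (Fin k → Bool) → List α) (query : Fin k → Bool → List α),
      ∀ f i b, data f ++ query i b ∈ SW pad L (A + k * B) ↔ f i = b := by
  obtain ⟨X, Y, u, v, z, hXY, huv, hu, hv, hmem⟩ := exists_blocks_of_notMem_LILen hL h
  have hX : X ≠ [] := by
    rintro rfl
    obtain rfl := List.suffix_nil.1 hu
    obtain rfl := List.length_eq_zero_iff.1 huv.symm
    exact (hmem []).2 (hmem []).1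
  refine ⟨u.length + z.length, 2 * X.length, by simpa [List.length_pos_iff] using hX, fun k => ?_⟩
  -- The bits and their negations are stored, so that `f i = b` is always queried as `true`.
  let stored (f : Fin k → Bool) : List Bool := List.ofFn f ++ List.ofFn fun i => !f i
  let position (i : Fin k) (b : Bool) : ℕ := cond b i (k + i)
  refine ⟨fun f => blocks X Y (stored f),
    fun i b => blocks X Y (List.replicate (position i b + 1) true) ++ z, fun f i b => ?_⟩
  have hlength : (stored f).length = 2 * k := by
    simp only [stored, List.length_append, List.length_ofFn]
    omega
  have hposition : position i b < (stored f).length := by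
    rw [hlength]
    cases b <;> simp only [position, cond_true, cond_false] <;> omega
  have hget : (stored f)[position i b] = true ↔ f i = b := by cases b <;> simp [stored, position]
  have hsplit :
      blocks X Y (stored f) ++ (blocks X Y (List.replicate (position i b + 1) true) ++ z) =
        blocks X Y ((stored f).take (position i b) ++ (stored f)[position i b] ::
          ((stored f).drop (position i b + 1) ++ List.replicate (position i b + 1) true)) ++ z := by
    rw [← List.cons_append, ← List.drop_eq_getElem_cons, ← List.append_assoc,
      ← List.append_assoc, List.take_append_drop, blocks_append _ _ (stored f)]
  have hwindow : u.length + z.length + k * (2 * X.length) = u.length +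
      (((stored f).drop (position i b + 1) ++
        List.replicate (position i b + 1) true).length * X.length + z.length) := by
    rw [List.length_append, List.length_drop, List.length_replicate, Nat.sub_add_cancel hposition,
      hlength]
    ring
  rw [hsplit, hwindow, append_blocks_append_mem_SW_iff hXY huv hu hv hmem, hget]

theorem exists_trueBiased_two_pow_le_card {α : Type*} (pad : α) {L : Language α} (hL : L.IsRegular)
    (h : L ∉ LILen α) :
    ∃ A B, 0 < B ∧ ∀ (j : ℕ) (Q : Type) [Finite Q] (P : RandomizedAlgorithm α Q),
      P.IsTrueBiasedFor (SW pad L (A + j * B)) → 2 ^ (2 * j) ≤ Nat.card Q := by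
  obtain ⟨A, B, hB, hwords⟩ := exists_index_words pad hL h
  refine ⟨A, 3 * B, by omega, fun j Q _ P hP => ?_⟩
  obtain ⟨data, query, hmem⟩ := hwords (3 * j)
  rw [show A + j * (3 * B) = A + 3 * j * B by ring] at hP
  refine two_pow_le_card_of_randomized_decoding (δ := 2 / 3) (fun f => P.run (data f))
    (fun m i b => (P.startFrom m).acceptProb (query i b) ≠ 0) (fun f i m hm hacc => ?_)
    (fun f i => ?_) ?_
  · have := hP.acceptProb_ne_zero_iff.1 (P.acceptProb_append_ne_zero hm hacc)
    simp [hmem] at this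
  · exact ((hP _).1 ((hmem f i (f i)).2 rfl)).trans (P.acceptProb_append_le _ _)
  · rw [Fintype.card_fin]
    push_cast
    rw [mul_right_comm, ENNReal.mul_div_cancel (by simp) (by simp)]

end IndexProblem

section UpperBounds

variable {α : Type*} {pad : α} {g : ℕ → ℕ} {N N' : ℕ} {K K' L : Language α}

theorem length_lastWindow (pad : α) (n : ℕ) (w : List α) : (lastWindow pad n w).length = n := by
  unfold lastWindow
  split_ifs <;> simp <;> omega

theorem lastWindow_suffix (pad : α) (n : ℕ) (w : List α) :
    lastWindow pad n w <:+ List.replicate n pad ++ w := by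
  unfold lastWindow
  split_ifs with h
  · exact (List.drop_suffix _ _).trans (List.suffix_append _ _)
  · refine ⟨List.replicate w.length pad, ?_⟩
    rw [← List.append_assoc, ← List.replicate_add, Nat.add_sub_cancel' (not_le.1 h).le]

theorem mem_SW_top_mul_iff {n : ℕ} {w : List α} :
    w ∈ SW pad (⊤ * K) n ↔ ∃ y ∈ K, y.length ≤ n ∧ y <:+ List.replicate n pad ++ w := by
  refine mem_top_mul_iff.trans (exists_congr fun y => and_congr_right fun _ => ⟨fun h => ?_, ?_⟩)
  · exact ⟨h.length_le.trans_eq (length_lastWindow pad n w), h.trans (lastWindow_suffix pad n w)⟩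
  · rintro ⟨hlen, h⟩
    refine List.suffix_of_suffix_length_le h (lastWindow_suffix pad n w) ?_
    rwa [length_lastWindow]

/-- `K` is accepted by a deterministic automaton with at most `N` states. -/
def HasDFAOfCardLE (K : Language α) (N : ℕ) : Prop :=
  ∃ (Q : Type) (_ : Finite Q) (M : DFA α Q), M.accepts = K ∧ Nat.card Q ≤ N

theorem HasDFAOfCardLE.mono (h : HasDFAOfCardLE K N) (hN : N ≤ N') : HasDFAOfCardLE K N' := by
  obtain ⟨Q, hQ, M, hM, hcard⟩ := h
  exact ⟨Q, hQ, M, hM, hcard.trans hN⟩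

theorem HasDFAOfCardLE.compl (h : HasDFAOfCardLE K N) : HasDFAOfCardLE Kᶜ N := by
  obtain ⟨Q, hQ, M, rfl, hcard⟩ := h
  exact ⟨Q, hQ, Mᶜ, DFA.accepts_compl M, hcard⟩

theorem HasDFAOfCardLE.sup (h : HasDFAOfCardLE K N) (h' : HasDFAOfCardLE K' N') :
    HasDFAOfCardLE (K ⊔ K') (N * N') := by
  obtain ⟨Q, _, M, rfl, hcard⟩ := h
  obtain ⟨Q', _, M', rfl, hcard'⟩ := h'
  refine ⟨Q × Q', inferInstance, M.union M', DFA.accepts_union M M', ?_⟩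
  rw [Nat.card_prod]
  exact Nat.mul_le_mul hcard hcard'

theorem hasDFAOfCardLE_of_leftQuotient_eq {S : Type*} [Finite S] (f : List α → S)
    (h : ∀ v w, f v = f w → K.leftQuotient v = K.leftQuotient w) :
    HasDFAOfCardLE K (Nat.card S) := by
  obtain ⟨q, hq⟩ := Function.factorsThrough_iff K.leftQuotient |>.1 fun v w => h v w
  have hrange : Set.range K.leftQuotient ⊆ Set.range q := hq ▸ Set.range_comp_subset_range f q
  have := ((Set.finite_range q).subset hrange).to_subtype
  refine ⟨Fin (Nat.card (Set.range K.leftQuotient)), inferInstance,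
    DFA.reindex (Finite.equivFin _) K.toDFA, ?_, ?_⟩
  · rw [DFA.accepts_reindex, Language.accepts_toDFA]
  · rw [Nat.card_fin]
    exact (Nat.card_mono (Set.finite_range q) hrange).trans (Finite.card_range_le q)

/-- For all large `n`, the sliding window problem of `L` for window length `n` has a deterministic
automaton with at most `(g n) ^ C` states, where `C` depends on `L` only. -/
def HasPowBoundedDFA (g : ℕ → ℕ) (pad : α) (L : Language α) : Prop :=
  ∃ C : ℕ, ∀ᶠ n in atTop, HasDFAOfCardLE (SW pad L n) (g n ^ C)

theorem HasPowBoundedDFA.compl (h : HasPowBoundedDFA g pad L) : HasPowBoundedDFA g pad Lᶜ := by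
  obtain ⟨C, hC⟩ := h
  exact ⟨C, hC.mono fun n hn => hn.compl⟩

theorem HasPowBoundedDFA.sup (h : HasPowBoundedDFA g pad K) (h' : HasPowBoundedDFA g pad L) :
    HasPowBoundedDFA g pad (K ⊔ L) := by
  obtain ⟨C, hC⟩ := h
  obtain ⟨C', hC'⟩ := h'
  refine ⟨C + C', (hC.and hC').mono fun n hn => ?_⟩
  rw [pow_add]
  exact hn.1.sup hn.2

theorem RegularLength.hasPowBoundedDFA (g : ℕ → ℕ) (pad : α) (hL : L ∈ RegularLength α) :
    HasPowBoundedDFA g pad L := by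
  refine ⟨0, Eventually.of_forall fun n => ?_⟩
  have hiff (v w : List α) : v ∈ SW pad L n ↔ w ∈ SW pad L n := by
    rcases hL.2 n with h | h
    · exact iff_of_true (h _ (length_lastWindow pad n v)) (h _ (length_lastWindow pad n w))
    · exact iff_of_false (h _ (length_lastWindow pad n v)) (h _ (length_lastWindow pad n w))
  have hquot (v w : List α) : (SW pad L n).leftQuotient v = (SW pad L n).leftQuotient w :=
    Set.ext fun s => hiff (v ++ s) (w ++ s)
  simpa using hasDFAOfCardLE_of_leftQuotient_eq (fun _ => ()) fun v w _ => hquot v w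

theorem hasPowBoundedDFA_top_mul_singleton (pad : α) (u : List α) :
    HasPowBoundedDFA (fun _ => 2) pad ((⊤ : Language α) * ({u} : Language α)) := by
  obtain ⟨σ, _, M, hM⟩ := isRegular_top_mul (isRegular_singleton u)
  refine ⟨Nat.card σ, (eventually_ge_atTop u.length).mono fun n hn => ?_⟩
  have hSW (w : List α) : w ∈ SW pad ((⊤ : Language α) * ({u} : Language α)) n ↔
      List.replicate n pad ++ w ∈ M.accepts := by
    rw [hM, mem_SW_top_mul_iff, mem_top_mul_iff]
    exact exists_congr fun y => and_congr_right fun hy =>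
      and_iff_right ((congrArg List.length (show y = u from hy)).trans_le hn)
  refine (hasDFAOfCardLE_of_leftQuotient_eq (fun w => M.eval (List.replicate n pad ++ w))
    fun v w hvw => ?_).mono (by simpa using Nat.lt_two_pow_self.le)
  ext s
  rw [Language.mem_leftQuotient, Language.mem_leftQuotient, hSW, hSW, ← List.append_assoc,
    ← List.append_assoc, ← Language.mem_leftQuotient, ← Language.mem_leftQuotient,
    Language.leftQuotient_accepts_apply, Language.leftQuotient_accepts_apply, hvw]

/-- The least length of a suffix of `v` that leads from the initial state of `M` to the state `p`,
or `n + 1` if there is no such suffix of length at most `n`. -/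
noncomputable def shortestSuffix {σ : Type*} (M : DFA α σ) (n : ℕ) (v : List α) (p : σ) : ℕ :=
  sInf {i | i = n + 1 ∨ ∃ s, s <:+ v ∧ M.eval s = p ∧ s.length = i}

theorem shortestSuffix_le {σ : Type*} (M : DFA α σ) (n : ℕ) (v : List α) (p : σ) :
    shortestSuffix M n v p ≤ n + 1 :=
  Nat.sInf_le (.inl rfl)

theorem shortestSuffix_le_iff {σ : Type*} {M : DFA α σ} {n i : ℕ} (hi : i ≤ n) {v : List α}
    {p : σ} : shortestSuffix M n v p ≤ i ↔ ∃ s, s <:+ v ∧ M.eval s = p ∧ s.length ≤ i := by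
  constructor
  · intro h
    have hmem := Nat.sInf_mem (s := {i | i = n + 1 ∨ ∃ s, s <:+ v ∧ M.eval s = p ∧ s.length = i})
      ⟨n + 1, .inl rfl⟩
    rcases hmem with htop | ⟨s, hs, hp, hlen⟩
    · exact absurd (htop.symm.trans_le h) (by omega)
    · exact ⟨s, hs, hp, hlen.trans_le h⟩
  · rintro ⟨s, hs, hp, hlen⟩
    exact (Nat.sInf_le (.inr ⟨s, hs, hp, rfl⟩)).trans hlen

theorem append_mem_SW_top_mul_accepts_iff {σ : Type*} {M : DFA α σ} {n : ℕ} {v s : List α} :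
    v ++ s ∈ SW pad (⊤ * M.accepts) n ↔ (∃ y ∈ M.accepts, y.length ≤ n ∧ y <:+ s) ∨
      s.length ≤ n ∧ ∃ p, M.evalFrom p s ∈ M.accept ∧
        shortestSuffix M n (List.replicate n pad ++ v) p ≤ n - s.length := by
  simp only [mem_SW_top_mul_iff, ← List.append_assoc, suffix_append_iff, and_or_left, exists_or,
    shortestSuffix_le_iff (Nat.sub_le n s.length)]
  refine or_congr_right ⟨?_, ?_⟩
  · rintro ⟨_, hacc, hlen, t, ht, rfl⟩
    rw [List.length_append] at hlen
    rw [DFA.mem_accepts, DFA.eval, DFA.evalFrom_of_append] at hacc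
    exact ⟨by omega, M.eval t, hacc, t, ht, rfl, by omega⟩
  · rintro ⟨hs, _, hacc, t, ht, rfl, hlen⟩
    refine ⟨t ++ s, ?_, by rw [List.length_append]; omega, t, ht, rfl⟩
    rwa [DFA.mem_accepts, DFA.eval, DFA.evalFrom_of_append]

theorem RegularLeftIdeal.hasPowBoundedDFA (pad : α) (hL : L ∈ RegularLeftIdeal α) :
    HasPowBoundedDFA (fun n => n) pad L := by
  obtain ⟨K, ⟨σ, _, M, rfl⟩, rfl⟩ := hL
  refine ⟨2 * Nat.card σ, (eventually_ge_atTop 2).mono fun n hn => ?_⟩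
  let lengths (w : List α) (p : σ) : Fin (n + 2) :=
    ⟨shortestSuffix M n (List.replicate n pad ++ w) p, Nat.lt_succ_of_le (shortestSuffix_le ..)⟩
  refine (hasDFAOfCardLE_of_leftQuotient_eq lengths fun v w hvw => ?_).mono ?_
  · have hshortest (p : σ) : shortestSuffix M n (List.replicate n pad ++ v) p =
        shortestSuffix M n (List.replicate n pad ++ w) p :=
      congrArg Fin.val (congrFun hvw p)
    ext s
    simp only [Language.mem_leftQuotient, append_mem_SW_top_mul_accepts_iff, hshortest]
  · rw [Nat.card_fun, Nat.card_fin, pow_mul]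
    exact Nat.pow_le_pow_left (by nlinarith) _

/-- The Boolean algebra of languages with sliding window automata of size polynomial in `g`. -/
def powBoundedDFA (g : ℕ → ℕ) (pad : α) : BooleanSubalgebra (Language α) where
  carrier := {L | HasPowBoundedDFA g pad L}
  supClosed' _ h _ h' := h.sup h'
  infClosed' K h L h' := by
    have := (h.compl.sup h'.compl).compl
    rwa [compl_sup, compl_compl, compl_compl] at this
  compl_mem' h := h.compl
  bot_mem' := RegularLength.hasPowBoundedDFA g pad
    ⟨isRegular_iff_finite_range_rightQuotient.2 ((Set.finite_singleton ⊥).subset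
      (Set.range_subset_iff.2 fun _ => rfl)), fun _ => .inr fun _ _ => id⟩

theorem STLen.hasPowBoundedDFA (pad : α) (hL : L ∈ STLen α) :
    HasPowBoundedDFA (fun _ => 2) pad L := by
  have hST : BooleanSubalgebra.closure
      {K : Language α | ∃ w : List α, K = (⊤ : Language α) * ({w} : Language α)} ≤
      powBoundedDFA (fun _ => 2) pad := by
    rw [BooleanSubalgebra.closure_le]
    rintro _ ⟨w, rfl⟩
    exact hasPowBoundedDFA_top_mul_singleton pad w
  have hSTLen : BooleanSubalgebra.closure (SuffixTestable α ∪ RegularLength α) ≤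
      powBoundedDFA (fun _ => 2) pad := by
    rw [BooleanSubalgebra.closure_le]
    rintro K (hK | hK)
    exacts [hST hK, RegularLength.hasPowBoundedDFA _ pad hK]
  exact hSTLen hL

theorem LILen.hasPowBoundedDFA (pad : α) (hL : L ∈ LILen α) :
    HasPowBoundedDFA (fun n => n) pad L := by
  have hLILen : BooleanSubalgebra.closure (RegularLeftIdeal α ∪ RegularLength α) ≤
      powBoundedDFA (fun n => n) pad := by
    rw [BooleanSubalgebra.closure_le]
    rintro K (hK | hK)
    exacts [RegularLeftIdeal.hasPowBoundedDFA pad hK, RegularLength.hasPowBoundedDFA _ pad hK]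
  exact hLILen hL

theorem HasPowBoundedDFA.trueBiasedComplexity_bigO (h : HasPowBoundedDFA g pad L) :
    BigO (trueBiasedComplexity pad L) fun n => Real.logb 2 (g n) := by
  obtain ⟨C, hC⟩ := h
  refine ⟨C, hC.mono ?_⟩
  rintro n ⟨Q, hQ, M, hM, hcard⟩
  refine iInf₂_le_of_le Q (.ofDFA M)
    (iInf_le_of_le (hM ▸ RandomizedAlgorithm.isTrueBiasedFor_ofDFA M) ?_)
  have : Nonempty Q := ⟨M.start⟩
  rw [space, if_pos hQ, ← Real.logb_pow]
  refine ENNReal.ofReal_le_ofReal (Real.logb_le_logb_of_le one_lt_two ?_ ?_)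
  · exact_mod_cast Nat.card_pos
  · exact_mod_cast hcard

theorem trueBiasedComplexity_bigO_one (pad : α) (hL : L ∈ STLen α) :
    BigO (trueBiasedComplexity pad L) fun _ => 1 := by
  simpa using (STLen.hasPowBoundedDFA pad hL).trueBiasedComplexity_bigO

theorem trueBiasedComplexity_bigO_logb (pad : α) (hL : L ∈ LILen α) :
    BigO (trueBiasedComplexity pad L) fun n => Real.logb 2 n :=
  (LILen.hasPowBoundedDFA pad hL).trueBiasedComplexity_bigO

end UpperBounds

section LowerBounds

variable {α : Type*} {L : Language α}

theorem falseBiasedComplexity_eq_trueBiasedComplexity_compl (pad : α) (L : Language α) :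
    falseBiasedComplexity pad L = trueBiasedComplexity pad Lᶜ := by
  funext n
  refine le_antisymm (le_iInf₂ fun Q P => le_iInf fun hP => ?_)
    (le_iInf₂ fun Q P => le_iInf fun hP => ?_)
  · refine iInf₂_le_of_le Q P.compl (iInf_le_of_le (P.compl.isTrueBiasedFor_compl_iff.1 ?_) le_rfl)
    rwa [P.compl_compl]
  · exact iInf₂_le_of_le Q P.compl (iInf_le _ (P.isTrueBiasedFor_compl_iff.2 hP))

theorem ofReal_le_trueBiasedComplexity {pad : α} {n : ℕ} {r : ℝ}
    (h : ∀ (Q : Type) [Finite Q] [Nonempty Q] (P : RandomizedAlgorithm α Q),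
      P.IsTrueBiasedFor (SW pad L n) → r ≤ Real.logb 2 (Nat.card Q)) :
    ENNReal.ofReal r ≤ trueBiasedComplexity pad L n := by
  refine le_iInf₂ fun Q P => le_iInf fun hP => ?_
  rw [space]
  split_ifs with hQ
  · have : Nonempty Q := P.init.support_nonempty.nonempty
    exact ENNReal.ofReal_le_ofReal (h Q P hP)
  · exact le_top

theorem frequently_sqrt_le_card_nfa [Finite α] (pad : α) (hL : L.IsRegular) (h : L ∉ STLen α) :
    ∃ c : ℝ, 0 < c ∧ ∃ᶠ n : ℕ in atTop, ∀ (Q : Type) [Finite Q] (P : NFA α Q),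
      P.accepts = SW pad L n → c * √(n : ℝ) ≤ (Nat.card Q : ℝ) := by
  obtain ⟨x, y, z, w, hxy, hz, hxz, hx, hy, hzw⟩ := exists_pumping_of_notMem_STLen hL h
  have hz_pos : 0 < z.length := List.length_pos_iff.2 hz
  let D := 2 * (x.length + (w.length + z.length))
  have hD : (0 : ℝ) < D := by exact_mod_cast (by omega : 0 < D)
  refine ⟨1 / √(D : ℝ), by positivity, frequently_atTop.2 fun a =>
    ⟨x.length + (w.length + (a + 1) * z.length), by nlinarith, fun Q _ P hP => ?_⟩⟩
  have hlt := lt_two_mul_card_sq_of_accepts_eq_SW hxy hxz hx hy hzw hP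
  have hle : x.length + (w.length + (a + 1) * z.length) ≤ D * Nat.card Q ^ 2 := by
    calc x.length + (w.length + (a + 1) * z.length)
        ≤ (x.length + (w.length + z.length)) * (a + 1) := by nlinarith
      _ ≤ (x.length + (w.length + z.length)) * (2 * Nat.card Q ^ 2) :=
        Nat.mul_le_mul_left _ hlt.le
      _ = D * Nat.card Q ^ 2 := by ring
  rw [one_div, inv_mul_le_iff₀ (by positivity), ← Real.sqrt_sq (Nat.cast_nonneg (Nat.card Q)),
    ← Real.sqrt_mul hD.le]
  exact Real.sqrt_le_sqrt (by exact_mod_cast hle)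

theorem trueBiasedComplexity_bigOmegaInf_logb [Finite α] (pad : α) (hL : L.IsRegular)
    (h : L ∉ STLen α) : BigOmegaInf (trueBiasedComplexity pad L) fun n => Real.logb 2 n := by
  obtain ⟨c, hc, hfreq⟩ := frequently_sqrt_le_card_nfa pad hL h
  have hlog : Tendsto (fun n : ℕ => Real.logb 2 n) atTop atTop :=
    (Real.tendsto_logb_atTop one_lt_two).comp tendsto_natCast_atTop_atTop
  have hlarge := (hlog.eventually_ge_atTop (-4 * Real.logb 2 c)).and (eventually_gt_atTop 0)
  refine ⟨1 / 4, by norm_num, (hfreq.and_eventually hlarge).mono ?_⟩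
  rintro n ⟨hn, hcn, hn_pos⟩
  refine ofReal_le_trueBiasedComplexity fun Q _ _ P hP => ?_
  have hn_pos' : (0 : ℝ) < n := Nat.cast_pos.2 hn_pos
  calc 1 / 4 * Real.logb 2 n ≤ Real.logb 2 c + 1 / 2 * Real.logb 2 n := by linarith
    _ = Real.logb 2 (c * √(n : ℝ)) := by
      rw [Real.logb_mul hc.ne' (by positivity), Real.sqrt_eq_rpow, Real.logb_rpow_eq_mul_logb_of_pos
        hn_pos']
    _ ≤ Real.logb 2 (Nat.card Q) := Real.logb_le_logb_of_le one_lt_two (by positivity)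
      (hn Q P.toNFA hP.accepts_toNFA)

theorem trueBiasedComplexity_bigOmegaInf_natCast (pad : α) (hL : L.IsRegular) (h : L ∉ LILen α) :
    BigOmegaInf (trueBiasedComplexity pad L) fun n => n := by
  obtain ⟨A, B, hB, hcard⟩ := exists_trueBiased_two_pow_le_card pad hL h
  have : (0 : ℝ) < B := Nat.cast_pos.2 hB
  refine ⟨1 / (A + B), by positivity, frequently_atTop.2 fun a =>
    ⟨A + (a + 1) * B, by nlinarith, ofReal_le_trueBiasedComplexity fun Q _ _ P hP => ?_⟩⟩
  calc 1 / (A + B : ℝ) * (A + (a + 1) * B : ℕ) ≤ (2 * (a + 1) : ℕ) := by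
        rw [one_div, inv_mul_le_iff₀ (by positivity)]
        exact_mod_cast (by nlinarith : A + (a + 1) * B ≤ (A + B) * (2 * (a + 1)))
    _ = Real.logb 2 (2 ^ (2 * (a + 1))) := by
        rw [Real.logb_pow, Real.logb_self_eq_one one_lt_two, mul_one]
    _ ≤ Real.logb 2 (Nat.card Q) := Real.logb_le_logb_of_le one_lt_two (by positivity)
      (by exact_mod_cast hcard (a + 1) Q P hP)

theorem compl_mem_STLen_iff : Lᶜ ∈ STLen α ↔ L ∈ STLen α :=
  BooleanSubalgebra.compl_mem_iff
    (L := BooleanSubalgebra.closure (SuffixTestable α ∪ RegularLength α))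

theorem compl_mem_LILen_iff : Lᶜ ∈ LILen α ↔ L ∈ LILen α :=
  BooleanSubalgebra.compl_mem_iff
    (L := BooleanSubalgebra.closure (RegularLeftIdeal α ∪ RegularLength α))

end LowerBounds

end SlidingWindow

theorem mainTheorem5 {α : Type*} [Finite α] (pad : α) (L : Language α) (hL : L.IsRegular) :
    (L ∈ SlidingWindow.STLen α →
      SlidingWindow.BigO (SlidingWindow.trueBiasedComplexity pad L) (fun _ => 1) ∧
      SlidingWindow.BigO (SlidingWindow.falseBiasedComplexity pad L) (fun _ => 1)) ∧
    (L ∉ SlidingWindow.STLen α →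
      SlidingWindow.BigOmegaInf (SlidingWindow.trueBiasedComplexity pad L)
        (fun n => Real.logb 2 n) ∧
      SlidingWindow.BigOmegaInf (SlidingWindow.falseBiasedComplexity pad L)
        (fun n => Real.logb 2 n)) ∧
    (L ∈ SlidingWindow.LILen α →
      SlidingWindow.BigO (SlidingWindow.trueBiasedComplexity pad L)
        (fun n => Real.logb 2 n) ∧
      SlidingWindow.BigO (SlidingWindow.falseBiasedComplexity pad L)
        (fun n => Real.logb 2 n)) ∧
    (L ∉ SlidingWindow.LILen α →
      SlidingWindow.BigOmegaInf (SlidingWindow.trueBiasedComplexity pad L) (fun n => n) ∧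
      SlidingWindow.BigOmegaInf (SlidingWindow.falseBiasedComplexity pad L) (fun n => n)) ∧
    (L ∉ SlidingWindow.STLen α →
      ∃ c : ℝ, 0 < c ∧ ∃ᶠ n : ℕ in Filter.atTop,
        ∀ (Q : Type) [Finite Q] (P : NFA α Q), P.accepts = SlidingWindow.SW pad L n →
          c * √(n : ℝ) ≤ (Nat.card Q : ℝ)) := by
  open SlidingWindow in
  rw [falseBiasedComplexity_eq_trueBiasedComplexity_compl]
  refine ⟨fun h => ⟨?_, ?_⟩, fun h => ⟨?_, ?_⟩, fun h => ⟨?_, ?_⟩, fun h => ⟨?_, ?_⟩, fun h => ?_⟩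
  · exact trueBiasedComplexity_bigO_one pad h
  · exact trueBiasedComplexity_bigO_one pad (compl_mem_STLen_iff.2 h)
  · exact trueBiasedComplexity_bigOmegaInf_logb pad hL h
  · exact trueBiasedComplexity_bigOmegaInf_logb pad hL.compl (compl_mem_STLen_iff.not.2 h)
  · exact trueBiasedComplexity_bigO_logb pad h
  · exact trueBiasedComplexity_bigO_logb pad (compl_mem_LILen_iff.2 h)
  · exact trueBiasedComplexity_bigOmegaInf_natCast pad hL h
  · exact trueBiasedComplexity_bigOmegaInf_natCast pad hL.compl (compl_mem_LILen_iff.not.2 h)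
  · exact frequently_sqrt_le_card_nfa pad hL h
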